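/- Let $p$ be a prime number and let $\mathbb{C}_p$ be the completion of an algebraic closure of $\mathbb{Q}_p$, with absolute value $|\cdot|_p$. Let $\log_p:\mathbb{C}_p^*\to\mathbb{C}_p$ be the $p$-adic logarithm, i.e. the unique extension of $\log_p(x)=\sum_{n\ge 1}(-1)^{n+1}(x-1)^n/n$ (for $|x-1|_p<1$) to a group homomorphism with $\log_p(\zeta p^s)=0$ for all roots of unity $\zeta$ and all $s\in\mathbb{Z}$. The $p$-adic Schanuel Conjecture (logarithmic formulation) is the assertion: whenever $\alpha_1,\dots,\alpha_n\in\mathbb{C}_p$ are non-zero and algebraic over $\mathbb{Q}$, and $\log_p\alpha_1,\dots,\log_p\alpha_n$ are linearly independent over $\mathbb{Q}$, then $\log_p\alpha_1,\dots,\log_p\alpha_n$ are algebraically independent over $\mathbb{Q}$. Let $M$ be a finite Galois extension of $\mathbb{Q}$ with ring of integers $\mathcal{O}_M$. For each prime ideal $\mathfrak{p}$ of $\mathcal{O}_M$ above $p$ let $M_\mathfrak{p}$ be the completion of $M$ at $\mathfrak{p}$, let $\mathcal{O}_\mathfrak{p}$ be its ring of integers with uniformizer $\pi$, and let $\mathcal{O}_{\mathfrak{p},1}^*=1+\pi\mathcal{O}_\mathfrak{p}$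 be the group of principal local units, which is a $\mathbb{Z}_p$-module via $u^a=\lim_n u^{a_n}$ for integers $a_n\to a\in\mathbb{Z}_p$. Let $X\subseteq\mathcal{O}_M^*$ be the subgroup of those global units whose image in $M_\mathfrak{p}$ lies in $\mathcal{O}_{\mathfrak{p},1}^*$ for every $\mathfrak{p}\mid p$, let $\Delta:X\to\prod_{\mathfrak{p}\mid p}\mathcal{O}_{\mathfrak{p},1}^*$, $u\mapsto(u,\dots,u)$, be the diagonal embedding, and let $\overline{\Delta(X)}$ be the topological closure of $\Delta(X)$ in $\prod_{\mathfrak{p}\mid p}\mathcal{O}_{\mathfrak{p},1}^*$. **Theorem.** The $p$-adic Schanuel Conjecture implies Leopoldt's Conjecture for $M$ and $p$: if the $p$-adic Schanuel Conjecture holds for the prime $p$, then $$\operatorname{rk}_{\mathbb{Z}_p}\overline{\Delta(X)}=\operatorname{rk}_{\mathbb{Z}}\mathcal{O}_M^*.$$ -/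

import Mathlib

open Filter Topology NumberField IsDedekindDomain

/-! ### The `p`-adic logarithm and the `p`-adic Schanuel Conjecture -/

/-- The power series `log_p x = ∑_{n ≥ 1} (-1)^(n+1) (x - 1)^n / n`, convergent for
`|x - 1|_p < 1`. -/
noncomputable def padicLogSeries (p : ℕ) [Fact p.Prime] (x : ℂ_[p]) : ℂ_[p] :=
  ∑' n : ℕ, (-1) ^ n * (x - 1) ^ (n + 1) / ((n : ℂ_[p]) + 1)

open Classical in
/-- The `p`-adic logarithm on `ℂ_p`. It is given by the power series for `|x - 1|_p < 1`. For every
other `x ≠ 0` some `y = x ^ N * p ^ s` with `N ≥ 1`, `s ∈ ℤ` satisfies `|y - 1|_p < 1`, and the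
value is `(1 / N) * log_p y`. This does not depend on the choice of `N` and `s`, and is the unique
extension to `ℂ_pˣ` that is a homomorphism and kills the roots of unity and the powers of `p`.
(At `x = 0` the value is the irrelevant `0`.) -/
noncomputable def padicLog (p : ℕ) [Fact p.Prime] (x : ℂ_[p]) : ℂ_[p] :=
  if ‖x - 1‖ < 1 then padicLogSeries p x
  else if h : ∃ a : ℕ × ℤ, 0 < a.1 ∧ ‖x ^ a.1 * (p : ℂ_[p]) ^ a.2 - 1‖ < 1 then
    padicLogSeries p (x ^ h.choose.1 * (p : ℂ_[p]) ^ h.choose.2) / (h.choose.1 : ℂ_[p])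
  else 0

/-- The `p`-adic Schanuel Conjecture, logarithmic formulation: if `α₁, …, αₙ ∈ ℂ_p` are non-zero and
algebraic over `ℚ` and their `p`-adic logarithms are linearly independent over `ℚ`, then these
logarithms are algebraically independent over `ℚ`. -/
def PadicSchanuelConjecture (p : ℕ) [Fact p.Prime] : Prop :=
  ∀ (n : ℕ) (α : Fin n → ℂ_[p]), (∀ i, α i ≠ 0) → (∀ i, IsAlgebraic ℚ (α i)) →
    LinearIndependent ℚ (fun i => padicLog p (α i)) →
    AlgebraicIndependent ℚ (fun i => padicLog p (α i))

/-! ### Raising to `p`-adic exponents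

In this section `A` is an additively written commutative topological group. -/

section PadicExponents

/-- The element `a • x = lim (a_n • x)` where the natural numbers `a_n` tend to `a ∈ ℤ_p`
(in multiplicative notation, `x ^ a = lim x ^ a_n`). -/
noncomputable def padicSMul {p : ℕ} [Fact p.Prime] {A : Type*} [AddCommGroup A]
    [TopologicalSpace A] (a : ℤ_[p]) (x : A) : A :=
  haveI : Nonempty A := ⟨x⟩
  limUnder atTop (fun n : ℕ => a.appr n • x)

/-- The two conditions under which `p`-adic exponents make sense: `k • x` is small when `k ∈ ℤ` is
`p`-adically small, and the limits defining `a • x` exist. -/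
structure HasPadicExponents (p : ℕ) [Fact p.Prime] (A : Type*) [AddCommGroup A]
    [TopologicalSpace A] : Prop where
  small : ∀ (x : A), ∀ U ∈ 𝓝 (0 : A), ∃ m : ℕ, ∀ k : ℤ, (p : ℤ) ^ m ∣ k → k • x ∈ U
  lim : ∀ (a : ℤ_[p]) (x : A), ∃ y, Tendsto (fun n : ℕ => a.appr n • x) atTop (𝓝 y)

namespace HasPadicExponents

variable {p : ℕ} [Fact p.Prime] {A : Type*} [AddCommGroup A] [TopologicalSpace A]

theorem tendsto_appr (h : HasPadicExponents p A) (a : ℤ_[p]) (x : A) :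
    Tendsto (fun n : ℕ => a.appr n • x) atTop (𝓝 (padicSMul a x)) := by
  have : Nonempty A := ⟨x⟩
  exact tendsto_nhds_limUnder (h.lim a x)

theorem appr_eventually (a : ℤ_[p]) (m : ℕ) :
    ∀ᶠ n in atTop, (p : ℤ_[p]) ^ m ∣ a - (((a.appr n : ℕ) : ℤ) : ℤ_[p]) := by
  filter_upwards [eventually_ge_atTop m] with n hmn
  rw [Int.cast_natCast]
  exact (pow_dvd_pow _ hmn).trans (Ideal.mem_span_singleton.mp (PadicInt.appr_spec n a))

variable [IsTopologicalAddGroup A]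

theorem tendsto_int (h : HasPadicExponents p A) (a : ℤ_[p]) (x : A) (k : ℕ → ℤ)
    (hk : ∀ m : ℕ, ∀ᶠ n in atTop, (p : ℤ_[p]) ^ m ∣ a - (k n : ℤ_[p])) :
    Tendsto (fun n => k n • x) atTop (𝓝 (padicSMul a x)) := by
  have h0 : Tendsto (fun n : ℕ => (k n - (a.appr n : ℤ)) • x) atTop (𝓝 0) := by
    rw [tendsto_def]
    intro U hU
    obtain ⟨m, hm⟩ := h.small x U hU
    filter_upwards [hk m, eventually_ge_atTop m] with n hn hmn
    apply hm
    rw [← PadicInt.pow_p_dvd_int_iff]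
    have h1 : (p : ℤ_[p]) ^ m ∣ a - (a.appr n : ℤ_[p]) :=
      (pow_dvd_pow _ hmn).trans (Ideal.mem_span_singleton.mp (PadicInt.appr_spec n a))
    have h2 := dvd_sub h1 hn
    push_cast
    convert h2 using 1
    ring
  have h1 := h0.add (h.tendsto_appr a x)
  rw [zero_add] at h1
  refine h1.congr fun n => ?_
  rw [sub_smul, natCast_zsmul]
  abel

theorem small_padic (h : HasPadicExponents p A) (x : A) (U : Set A) (hU : U ∈ 𝓝 (0 : A)) :
    ∃ m : ℕ, ∀ c : ℤ_[p], (p : ℤ_[p]) ^ m ∣ c → padicSMul c x ∈ U := by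
  obtain ⟨V, hV, hVc, hVU⟩ := exists_mem_nhds_isClosed_subset hU
  obtain ⟨m, hm⟩ := h.small x V hV
  refine ⟨m, fun c hc => hVU (hVc.mem_of_tendsto (h.tendsto_appr c x) ?_)⟩
  filter_upwards [appr_eventually c m] with n hn
  rw [← natCast_zsmul]
  apply hm
  rw [← PadicInt.pow_p_dvd_int_iff]
  have := dvd_sub hc hn
  rwa [sub_sub_cancel] at this

variable [T2Space A]

theorem eq_of_tendsto (h : HasPadicExponents p A) (a : ℤ_[p]) (x y : A) (k : ℕ → ℤ)
    (hk : ∀ m : ℕ, ∀ᶠ n in atTop, (p : ℤ_[p]) ^ m ∣ a - (k n : ℤ_[p]))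
    (hy : Tendsto (fun n => k n • x) atTop (𝓝 y)) : padicSMul a x = y :=
  tendsto_nhds_unique (h.tendsto_int a x k hk) hy

theorem int_smul (h : HasPadicExponents p A) (k : ℤ) (x : A) :
    padicSMul (k : ℤ_[p]) x = k • x :=
  h.eq_of_tendsto _ _ _ (fun _ => k) (fun m => by simp) tendsto_const_nhds

theorem add_smul' (h : HasPadicExponents p A) (a b : ℤ_[p]) (x : A) :
    padicSMul (a + b) x = padicSMul a x + padicSMul b x := by
  refine h.eq_of_tendsto _ _ _ (fun n => (a.appr n : ℤ) + (b.appr n : ℤ)) (fun m => ?_) ?_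
  · filter_upwards [appr_eventually a m, appr_eventually b m] with n h1 h2
    have := dvd_add h1 h2
    push_cast at this ⊢
    convert this using 1
    ring
  · refine ((h.tendsto_appr a x).add (h.tendsto_appr b x)).congr fun n => ?_
    rw [add_smul, natCast_zsmul, natCast_zsmul]

theorem smul_add' (h : HasPadicExponents p A) (a : ℤ_[p]) (x y : A) :
    padicSMul a (x + y) = padicSMul a x + padicSMul a y := by
  refine tendsto_nhds_unique (h.tendsto_appr a (x + y)) ?_
  refine ((h.tendsto_appr a x).add (h.tendsto_appr a y)).congr fun n => ?_
  rw [smul_add]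

theorem int_mul_smul (h : HasPadicExponents p A) (k : ℤ) (b : ℤ_[p]) (x : A) :
    padicSMul ((k : ℤ_[p]) * b) x = k • padicSMul b x := by
  refine h.eq_of_tendsto _ _ _ (fun n => k * (b.appr n : ℤ)) (fun m => ?_) ?_
  · filter_upwards [appr_eventually b m] with n h1
    have := Dvd.dvd.mul_left h1 (k : ℤ_[p])
    push_cast at this ⊢
    rwa [mul_sub] at this
  · refine ((h.tendsto_appr b x).const_smul k).congr fun n => ?_
    rw [mul_smul, natCast_zsmul]

theorem mul_smul' (h : HasPadicExponents p A) (a b : ℤ_[p]) (x : A) :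
    padicSMul (a * b) x = padicSMul a (padicSMul b x) := by
  have h0 : Tendsto (fun n : ℕ => padicSMul ((a - ((a.appr n : ℤ) : ℤ_[p])) * b) x) atTop
      (𝓝 0) := by
    rw [tendsto_def]
    intro U hU
    obtain ⟨m, hm⟩ := h.small_padic x U hU
    filter_upwards [appr_eventually a m] with n hn
    exact hm _ (Dvd.dvd.mul_right hn b)
  have h1 := h0.add (h.tendsto_appr a (padicSMul b x))
  rw [zero_add] at h1
  refine tendsto_nhds_unique ?_ h1
  refine tendsto_const_nhds.congr fun n => ?_
  rw [← natCast_zsmul, ← h.int_mul_smul, ← h.add_smul']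
  congr 1
  ring

/-- The `ℤ_p`-module structure given by raising to `p`-adic exponents. -/
@[reducible]
noncomputable def module (h : HasPadicExponents p A) : Module ℤ_[p] A where
  smul := padicSMul
  one_smul x := by
    have := h.int_smul 1 x
    rwa [Int.cast_one, one_zsmul] at this
  mul_smul := h.mul_smul'
  smul_zero a := by
    have := h.smul_add' a 0 0
    rwa [add_zero, left_eq_add] at this
  smul_add := h.smul_add'
  add_smul := h.add_smul'
  zero_smul x := by
    have := h.int_smul 0 x
    rwa [Int.cast_zero, zero_zsmul] at this

end HasPadicExponents

end PadicExponents

/-! ### Principal units of a non-archimedean field -/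

section PrincipalUnits

variable (K : Type*) [NormedField K] [IsUltrametricDist K]

theorem norm_eq_one_of_norm_sub_one_lt {K : Type*} [NormedField K] [IsUltrametricDist K] {x : K}
    (hx : ‖x - 1‖ < 1) : ‖x‖ = 1 := by
  have h := IsUltrametricDist.norm_add_eq_max_of_norm_ne_norm (x := x - 1) (y := 1)
    (by rw [norm_one]; exact hx.ne)
  rwa [sub_add_cancel, norm_one, max_eq_right hx.le] at h

/-- The group `1 + π 𝒪` of principal units of a field `K` with a non-archimedean absolute value,
where `π 𝒪 = {x | |x| < 1}` is the maximal ideal of its valuation ring `𝒪`. -/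
def principalUnits : Subgroup Kˣ where
  carrier := {u | ‖(u : K) - 1‖ < 1}
  one_mem' := by simp
  mul_mem' {u w} hu hw := by
    have hu' : ‖(u : K) - 1‖ < 1 := hu
    have hw' : ‖(w : K) - 1‖ < 1 := hw
    change ‖((u * w : Kˣ) : K) - 1‖ < 1
    have e : ((u * w : Kˣ) : K) - 1 = u * ((w : K) - 1) + ((u : K) - 1) := by
      push_cast
      ring
    rw [e]
    refine (IsUltrametricDist.norm_add_le_max _ _).trans_lt (max_lt ?_ hu')
    rwa [norm_mul, norm_eq_one_of_norm_sub_one_lt hu', one_mul]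
  inv_mem' {u} hu := by
    have hu' : ‖(u : K) - 1‖ < 1 := hu
    change ‖((u⁻¹ : Kˣ) : K) - 1‖ < 1
    have e : ((u⁻¹ : Kˣ) : K) - 1 = -(((u : K))⁻¹ * ((u : K) - 1)) := by
      have : (u : K) ≠ 0 := u.ne_zero
      push_cast
      field_simp
      ring
    rw [e, norm_neg, norm_mul, norm_inv, norm_eq_one_of_norm_sub_one_lt hu']
    simpa using hu'

variable {K}

theorem norm_pow_sub_one_le {x : K} (hx : ‖x‖ = 1) (n : ℕ) : ‖x ^ n - 1‖ ≤ ‖x - 1‖ := by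
  induction n with
  | zero => simp
  | succ n ih =>
    have e : x ^ (n + 1) - 1 = x ^ n * (x - 1) + (x ^ n - 1) := by ring
    rw [e]
    refine (IsUltrametricDist.norm_add_le_max _ _).trans (max_le ?_ ih)
    rw [norm_mul, norm_pow, hx, one_pow, one_mul]

theorem norm_pow_prime_pow_sub_one_le {p : ℕ} {ρ : ℝ} (hp : ‖(p : K)‖ ≤ ρ) (hρ : ρ < 1) {x : K}
    (hx : ‖x - 1‖ ≤ ρ) (n : ℕ) : ‖x ^ p ^ n - 1‖ ≤ ρ ^ (n + 1) := by
  have hρ0 : 0 ≤ ρ := (norm_nonneg _).trans hp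
  have hx1 : ‖x‖ = 1 := norm_eq_one_of_norm_sub_one_lt (hx.trans_lt hρ)
  induction n with
  | zero => simpa using hx
  | succ n ih =>
    set y := x ^ p ^ n with hy
    have hy1 : ‖y‖ = 1 := by rw [hy, norm_pow, hx1, one_pow]
    have hyρ : ‖y - 1‖ ≤ ρ := (norm_pow_sub_one_le hx1 _).trans hx
    have e : x ^ p ^ (n + 1) - 1 = (∑ i ∈ Finset.range p, y ^ i) * (y - 1) := by
      rw [geom_sum_mul, hy, ← pow_mul, ← pow_succ]
    have e2 : (∑ i ∈ Finset.range p, y ^ i) = (∑ i ∈ Finset.range p, (y ^ i - 1)) + (p : K) := by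
      simp
    have hs : ‖∑ i ∈ Finset.range p, y ^ i‖ ≤ ρ := by
      rw [e2]
      refine (IsUltrametricDist.norm_add_le_max _ _).trans (max_le ?_ hp)
      exact IsUltrametricDist.norm_sum_le_of_forall_le_of_nonneg hρ0
        fun i _ => (norm_pow_sub_one_le hy1 i).trans hyρ
    rw [e, norm_mul, pow_succ' ρ (n + 1)]
    exact mul_le_mul hs ih (norm_nonneg _) hρ0

theorem principalUnits_tendsto_pow {p : ℕ} (hp : ‖(p : K)‖ < 1) (u : principalUnits K) {ε : ℝ}
    (hε : 0 < ε) : ∃ m : ℕ, ∀ k : ℤ, (p : ℤ) ^ m ∣ k → 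
    ‖(((u ^ k : principalUnits K) : Kˣ) : K) - 1‖ < ε := by
  have hu : ‖((u : Kˣ) : K) - 1‖ < 1 := u.2
  have hρ : max ‖(p : K)‖ ‖((u : Kˣ) : K) - 1‖ < 1 := max_lt hp hu
  have hρ0 : 0 ≤ max ‖(p : K)‖ ‖((u : Kˣ) : K) - 1‖ := le_max_of_le_left (norm_nonneg _)
  obtain ⟨m, hm⟩ := exists_pow_lt_of_lt_one hε hρ
  have key : ∀ w : principalUnits K, ∀ j : ℕ, ‖((w : Kˣ) : K) - 1‖ ≤
      max ‖(p : K)‖ ‖((u : Kˣ) : K) - 1‖ →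
      ‖(((w ^ (p ^ m * j) : principalUnits K) : Kˣ) : K) - 1‖ < ε := by
    intro w j hw
    have h1 := norm_pow_prime_pow_sub_one_le (le_max_left _ _) hρ hw m
    have hw1 : ‖((w : Kˣ) : K)‖ = 1 := norm_eq_one_of_norm_sub_one_lt w.2
    have h2 := norm_pow_sub_one_le (x := ((w : Kˣ) : K) ^ p ^ m) (by rw [norm_pow, hw1, one_pow]) j
    have e : (((w ^ (p ^ m * j) : principalUnits K) : Kˣ) : K) = (((w : Kˣ) : K) ^ p ^ m) ^ j := by
      push_cast
      rw [pow_mul]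
    rw [e]
    refine (h2.trans h1).trans_lt (lt_of_le_of_lt ?_ hm)
    exact pow_le_pow_of_le_one hρ0 hρ.le (Nat.le_succ m)
  refine ⟨m, ?_⟩
  rintro k ⟨j, rfl⟩
  obtain ⟨j, rfl | rfl⟩ := j.eq_nat_or_neg
  · have e : u ^ ((p : ℤ) ^ m * (j : ℤ)) = u ^ (p ^ m * j) := by
      rw [← zpow_natCast]
      push_cast
      rfl
    rw [e]
    exact key u j (le_max_right _ _)
  · have e : u ^ ((p : ℤ) ^ m * (-(j : ℤ))) = (u⁻¹) ^ (p ^ m * j) := by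
      rw [← zpow_natCast, mul_neg, zpow_neg, inv_zpow]
      push_cast
      rfl
    rw [e]
    refine key u⁻¹ j (le_max_of_le_right ?_)
    have hu1 : ‖((u : Kˣ) : K)‖ = 1 := norm_eq_one_of_norm_sub_one_lt hu
    have e : (((u⁻¹ : principalUnits K) : Kˣ) : K) - 1 =
        -((((u : Kˣ) : K))⁻¹ * (((u : Kˣ) : K) - 1)) := by
      have : ((u : Kˣ) : K) ≠ 0 := (u : Kˣ).ne_zero
      push_cast
      field_simp
      ring
    rw [e, norm_neg, norm_mul, norm_inv, hu1, inv_one, one_mul]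

theorem principalUnits_isEmbedding :
    IsEmbedding (fun x : Additive (principalUnits K) => ((x.toMul : Kˣ) : K)) :=
  (Units.isEmbedding_val₀.comp IsEmbedding.subtypeVal).comp
    (IsClosedEmbedding.of_continuous_injective_isClosedMap continuous_toMul
      Additive.toMul.injective isClosedMap_toMul).isEmbedding

instance : T2Space (Additive (principalUnits K)) :=
  principalUnits_isEmbedding.t2Space

theorem principalUnits_hasPadicExponents [CompleteSpace K] {p : ℕ} [Fact p.Prime]
    (hp : ‖(p : K)‖ < 1) : HasPadicExponents p (Additive (principalUnits K)) where
  small x U hU := by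
    rw [principalUnits_isEmbedding.isInducing.nhds_eq_comap, mem_comap] at hU
    obtain ⟨V, hV, hVU⟩ := hU
    obtain ⟨ε, hε, hεV⟩ := Metric.mem_nhds_iff.mp hV
    obtain ⟨m, hm⟩ := principalUnits_tendsto_pow hp x.toMul hε
    refine ⟨m, fun k hk => hVU (hεV ?_)⟩
    rw [Metric.mem_ball, dist_eq_norm]
    exact hm k hk
  lim a x := by
    set u : principalUnits K := x.toMul with hu
    have hu1 : ‖((u : Kˣ) : K)‖ = 1 := norm_eq_one_of_norm_sub_one_lt u.2
    have hc : CauchySeq (fun n : ℕ => ((u : Kˣ) : K) ^ a.appr n) := by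
      rw [Metric.cauchySeq_iff']
      intro ε hε
      obtain ⟨m, hm⟩ := principalUnits_tendsto_pow hp u hε
      refine ⟨m, fun n hn => ?_⟩
      have h1 := hm ((a.appr n - a.appr m : ℕ) : ℤ) (by
        exact_mod_cast PadicInt.dvd_appr_sub_appr a m n hn)
      rw [zpow_natCast] at h1
      push_cast at h1
      rw [dist_eq_norm]
      have e : ((u : Kˣ) : K) ^ a.appr n - ((u : Kˣ) : K) ^ a.appr m =
          ((u : Kˣ) : K) ^ a.appr m * (((u : Kˣ) : K) ^ (a.appr n - a.appr m) - 1) := by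
        rw [mul_sub, ← pow_add, Nat.add_sub_cancel' (PadicInt.appr_mono a hn), mul_one]
      rwa [e, norm_mul, norm_pow, hu1, one_pow, one_mul]
    obtain ⟨y, hy⟩ := cauchySeq_tendsto_of_complete hc
    have hy1 : ‖y - 1‖ < 1 := by
      have h2 : Tendsto (fun n : ℕ => ‖((u : Kˣ) : K) ^ a.appr n - 1‖) atTop (𝓝 ‖y - 1‖) :=
        (hy.sub_const 1).norm
      exact (le_of_tendsto h2 (Eventually.of_forall fun n => norm_pow_sub_one_le hu1 _)).trans_lt u.2
    have hy0 : y ≠ 0 := by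
      rintro rfl
      simp at hy1
    refine ⟨Additive.ofMul (⟨Units.mk0 y hy0, hy1⟩ : principalUnits K), ?_⟩
    rw [principalUnits_isEmbedding.isInducing.tendsto_nhds_iff]
    refine hy.congr fun n => ?_
    simp [hu]

end PrincipalUnits

/-! ### The diagonal image of the global units in the product of the principal local units -/

section Leopoldt

variable (p : ℕ) [Fact p.Prime] (M : Type*) [Field M] [NumberField M]

/-- The primes `𝔭` of `𝓞 M` above `p`. -/
abbrev PrimesAbove : Type _ := {v : HeightOneSpectrum (𝓞 M) // (p : 𝓞 M) ∈ v.asIdeal}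

/-- The group `1 + π 𝒪_𝔭` of principal local units of the completion `M_𝔭`, written additively. -/
abbrev PrincipalLocalUnits (v : PrimesAbove p M) : Type _ :=
  Additive (principalUnits (v.1.adicCompletion M))

variable {p M}

theorem norm_natCast_lt_one_of_primesAbove {p : ℕ} {M : Type*} [Field M] [NumberField M]
    (v : PrimesAbove p M) :
    ‖(p : v.1.adicCompletion M)‖ < 1 := by
  have := (FinitePlace.norm_lt_one_iff_mem M v.1 (p : 𝓞 M)).mpr v.2
  simpa using this

theorem principalLocalUnits_hasPadicExponents (v : PrimesAbove p M) :
    HasPadicExponents p (PrincipalLocalUnits p M v) :=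
  principalUnits_hasPadicExponents (norm_natCast_lt_one_of_primesAbove v)

/-- The `ℤ_p`-module structure on principal local units: `u ^ a` for `a ∈ ℤ_p`. -/
noncomputable instance (v : PrimesAbove p M) : Module ℤ_[p] (PrincipalLocalUnits p M v) :=
  (principalLocalUnits_hasPadicExponents v).module

variable (p M)

/-- The group `X` of those global units that lie in `1 + π 𝒪_𝔭` for every `𝔭` above `p`. -/
noncomputable def principalGlobalUnits : Subgroup (𝓞 M)ˣ :=
  ⨅ v : PrimesAbove p M,
    (principalUnits (v.1.adicCompletion M)).comap
      (Units.map (algebraMap (𝓞 M) (v.1.adicCompletion M)).toMonoidHom)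

/-- The diagonal embedding `Δ` of `X` into the product of the groups of principal local units. -/
noncomputable def diagonalEmbedding :
    Additive (principalGlobalUnits p M) →+ ∀ v : PrimesAbove p M, PrincipalLocalUnits p M v :=
  AddMonoidHom.pi fun v => MonoidHom.toAdditive
    (((Units.map (algebraMap (𝓞 M) (v.1.adicCompletion M)).toMonoidHom).comp
      (principalGlobalUnits p M).subtype).codRestrict (principalUnits (v.1.adicCompletion M))
      fun u => Subgroup.mem_iInf.mp u.2 v)

/-- The topological closure of `Δ(X)` in the product of the groups of principal local units; it is
a `ℤ_p`-submodule. -/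
noncomputable def closureDiagonalUnits :
    Submodule ℤ_[p] (∀ v : PrimesAbove p M, PrincipalLocalUnits p M v) where
  carrier := closure (Set.range (diagonalEmbedding p M))
  add_mem' := (diagonalEmbedding p M).range.topologicalClosure.add_mem
  zero_mem' := (diagonalEmbedding p M).range.topologicalClosure.zero_mem
  smul_mem' a x hx := by
    refine (isClosed_closure (s := Set.range (diagonalEmbedding p M))).mem_of_tendsto
      (f := fun n : ℕ => a.appr n • x) (b := atTop) ?_ (Eventually.of_forall fun n => ?_)
    · rw [tendsto_pi_nhds]
      exact fun v => (principalLocalUnits_hasPadicExponents v).tendsto_appr a (x v)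
    · exact (diagonalEmbedding p M).range.topologicalClosure.nsmul_mem hx (a.appr n)

end Leopoldt

section PadicLog

variable {p : ℕ} [Fact p.Prime]

theorem PadicComplex.norm_prime : ‖(p : ℂ_[p])‖ = (p : ℝ)⁻¹ := by
  rw [← Padic.norm_p (p := p), ← PadicComplex.norm_extends' p (p : ℚ_[p])]
  congr 1
  simp

theorem PadicComplex.norm_prime_lt_one : ‖(p : ℂ_[p])‖ < 1 := by
  rw [PadicComplex.norm_prime]
  exact inv_lt_one_of_one_lt₀ (by exact_mod_cast (Fact.out : p.Prime).one_lt)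

theorem PadicComplex.prime_ne_zero : (p : ℂ_[p]) ≠ 0 :=
  Nat.cast_ne_zero.mpr (Fact.out : p.Prime).ne_zero

theorem PadicComplex.inv_norm_natCast_le {k : ℕ} (hk : k ≠ 0) : ‖(k : ℂ_[p])‖⁻¹ ≤ k := by
  have h1 : ‖(k : ℂ_[p])‖ = ‖(k : ℚ_[p])‖ := by
    rw [← PadicComplex.norm_extends' p (k : ℚ_[p])]
    congr 1
    simp
  rw [h1, Padic.norm_eq_zpow_neg_valuation (by exact_mod_cast hk), zpow_neg, inv_inv,
    Padic.valuation_natCast, zpow_natCast]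
  exact_mod_cast Nat.le_of_dvd (Nat.pos_of_ne_zero hk) pow_padicValNat_dvd

theorem PadicComplex.norm_logTerm_le (x c : ℂ_[p]) (hc : ‖c‖ ≤ 1) (k : ℕ) :
    ‖c * x ^ (k + 1) / ((k : ℂ_[p]) + 1)‖ ≤ ((k + 1 : ℕ) : ℝ) * ‖x‖ ^ (k + 1) := by
  have h := PadicComplex.inv_norm_natCast_le (p := p) (Nat.succ_ne_zero k)
  push_cast at h
  rw [norm_div, norm_mul, norm_pow, div_eq_mul_inv, mul_comm]
  push_cast
  refine mul_le_mul h ?_ (by positivity) (by positivity)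
  exact mul_le_of_le_one_left (by positivity) hc

theorem summable_succ_mul_pow {r : ℝ} (hr0 : 0 ≤ r) (hr : r < 1) :
    Summable fun k : ℕ => ((k + 1 : ℕ) : ℝ) * r ^ (k + 1) := by
  have h := summable_pow_mul_geometric_of_norm_lt_one (R := ℝ) 1 (r := r)
    (by rwa [Real.norm_of_nonneg hr0])
  simpa using (summable_nat_add_iff 1).mpr h

theorem pow_sub_one_div_eq_tsum {K : Type*} [Field K] [CharZero K] [TopologicalSpace K] (x : K)
    {N : ℕ} (hN : N ≠ 0) :
    (x ^ N - 1) / (N : K) =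
      ∑' k : ℕ, ((N - 1).choose k : K) * (x - 1) ^ (k + 1) / ((k : K) + 1) := by
  obtain ⟨m, rfl⟩ := Nat.exists_eq_succ_of_ne_zero hN
  rw [tsum_eq_sum (s := Finset.range (m + 1))]
  · have hN' : ((m + 1 : ℕ) : K) ≠ 0 := by exact_mod_cast hN
    rw [div_eq_iff hN', Finset.sum_mul]
    have h := add_pow (x - 1) 1 (m + 1)
    rw [sub_add_cancel, Finset.sum_range_succ'] at h
    simp only [one_pow, mul_one, pow_zero, Nat.choose_zero_right, Nat.cast_one] at h
    rw [Nat.succ_eq_add_one, h, add_sub_cancel_right]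
    refine Finset.sum_congr rfl fun k _ => ?_
    have hk : (k : K) + 1 ≠ 0 := by exact_mod_cast Nat.succ_ne_zero k
    have hc : ((m + 1 : ℕ) : K) * (m.choose k : K) =
        ((m + 1).choose (k + 1) : K) * ((k : K) + 1) := by
      exact_mod_cast Nat.add_one_mul_choose_eq m k
    rw [Nat.add_sub_cancel, div_mul_eq_mul_div, eq_div_iff hk]
    linear_combination (-(x - 1) ^ (k + 1)) * hc
  · intro k hk
    rw [Finset.mem_range, not_lt] at hk
    rw [Nat.choose_eq_zero_of_lt (by simpa using hk)]
    simp

theorem PadicComplex.tendsto_choose (k : ℕ) :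
    Tendsto (fun n : ℕ => ((p ^ n - 1).choose k : ℂ_[p])) atTop (𝓝 ((-1) ^ k)) := by
  have hp := (Fact.out : p.Prime)
  induction k with
  | zero => simp
  | succ k ih =>
    have hpn : Tendsto (fun n : ℕ => (p : ℂ_[p]) ^ n) atTop (𝓝 0) :=
      tendsto_pow_atTop_nhds_zero_of_norm_lt_one PadicComplex.norm_prime_lt_one
    have h := ((hpn.mul ih).div_const ((k : ℂ_[p]) + 1)).sub ih
    rw [zero_mul, zero_div, zero_sub] at h
    rw [pow_succ, mul_neg_one]
    refine h.congr fun n => ?_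
    obtain ⟨m, hm⟩ := Nat.exists_eq_succ_of_ne_zero (pow_ne_zero n hp.ne_zero)
    have hk : (k : ℂ_[p]) + 1 ≠ 0 := by exact_mod_cast Nat.succ_ne_zero k
    have h1 : ((m + 1 : ℕ) : ℂ_[p]) * (m.choose k : ℂ_[p]) =
        ((m + 1).choose (k + 1) : ℂ_[p]) * ((k : ℂ_[p]) + 1) := by
      exact_mod_cast Nat.add_one_mul_choose_eq m k
    have h2 : ((m + 1).choose (k + 1) : ℂ_[p]) = m.choose k + m.choose (k + 1) := by
      exact_mod_cast Nat.choose_succ_succ m k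
    have h3 : (p : ℂ_[p]) ^ n = ((m + 1 : ℕ) : ℂ_[p]) := by exact_mod_cast hm
    rw [hm, h3, Nat.succ_eq_add_one, Nat.add_sub_cancel, h1, mul_div_cancel_right₀ _ hk, h2]
    ring

theorem tendsto_padicLogSeries {x : ℂ_[p]} (hx : ‖x - 1‖ < 1) :
    Tendsto (fun n : ℕ => (x ^ p ^ n - 1) / (p : ℂ_[p]) ^ n) atTop (𝓝 (padicLogSeries p x)) := by
  have h : Tendsto (fun n : ℕ => ∑' k : ℕ,
      ((p ^ n - 1).choose k : ℂ_[p]) * (x - 1) ^ (k + 1) / ((k : ℂ_[p]) + 1)) atTop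
      (𝓝 (padicLogSeries p x)) := by
    refine tendsto_tsum_of_dominated_convergence (summable_succ_mul_pow (norm_nonneg _) hx)
      (fun k => ((PadicComplex.tendsto_choose k).mul_const _).div_const _)
      (Eventually.of_forall fun n k => ?_)
    exact PadicComplex.norm_logTerm_le _ _ (IsUltrametricDist.norm_natCast_le_one _ _) k
  refine h.congr fun n => ?_
  rw [← pow_sub_one_div_eq_tsum x (pow_ne_zero n (Fact.out : p.Prime).ne_zero), Nat.cast_pow]

theorem padicLogSeries_one : padicLogSeries p 1 = 0 := by
  simp [padicLogSeries]

theorem norm_mul_sub_one_lt {K : Type*} [NormedField K] [IsUltrametricDist K] {x y : K}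
    (hx : ‖x - 1‖ < 1) (hy : ‖y - 1‖ < 1) : ‖x * y - 1‖ < 1 := by
  have e : x * y - 1 = x * (y - 1) + (x - 1) := by ring
  rw [e]
  refine (IsUltrametricDist.norm_add_le_max _ _).trans_lt (max_lt ?_ hx)
  rwa [norm_mul, norm_eq_one_of_norm_sub_one_lt hx, one_mul]

theorem padicLogSeries_mul {x y : ℂ_[p]} (hx : ‖x - 1‖ < 1) (hy : ‖y - 1‖ < 1) :
    padicLogSeries p (x * y) = padicLogSeries p x + padicLogSeries p y := by
  refine tendsto_nhds_unique (tendsto_padicLogSeries (norm_mul_sub_one_lt hx hy)) ?_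
  have hpn : Tendsto (fun n : ℕ => (p : ℂ_[p]) ^ n) atTop (𝓝 0) :=
    tendsto_pow_atTop_nhds_zero_of_norm_lt_one PadicComplex.norm_prime_lt_one
  have h1 := tendsto_padicLogSeries hx
  have h2 := tendsto_padicLogSeries hy
  have h := ((hpn.mul (h1.mul h2)).add h1).add h2
  rw [zero_mul, zero_add] at h
  refine h.congr fun n => ?_
  have : (p : ℂ_[p]) ^ n ≠ 0 := pow_ne_zero _ PadicComplex.prime_ne_zero
  field_simp
  ring

theorem padicLogSeries_pow {x : ℂ_[p]} (hx : ‖x - 1‖ < 1) (n : ℕ) :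
    padicLogSeries p (x ^ n) = n * padicLogSeries p x := by
  induction n with
  | zero => simp [padicLogSeries_one]
  | succ n ih =>
    have h := (norm_pow_sub_one_le (norm_eq_one_of_norm_sub_one_lt hx) n).trans_lt hx
    rw [pow_succ, padicLogSeries_mul h hx, ih]
    push_cast
    ring

theorem norm_padicLogSeries_le {x : ℂ_[p]} (hx : ‖x - 1‖ ≤ 1 / 2) :
    ‖padicLogSeries p x‖ ≤ 4 * ‖x - 1‖ := by
  set r := ‖x - 1‖ with hr
  have hr0 : 0 ≤ r := norm_nonneg _
  have h1 : HasSum (fun k : ℕ => ((k + 1 : ℕ) : ℝ) * r ^ (k + 1)) (r / (1 - r) ^ 2) := by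
    have h := hasSum_coe_mul_geometric_of_norm_lt_one (𝕜 := ℝ) (r := r)
      (by rw [Real.norm_of_nonneg hr0]; linarith)
    have h2 := (hasSum_nat_add_iff' 1).mpr h
    simpa using h2
  refine (tsum_of_norm_bounded h1 fun k => ?_).trans ?_
  · exact PadicComplex.norm_logTerm_le _ _ (by simp) k
  · rw [div_le_iff₀ (by nlinarith)]
    have : 0 ≤ r * (4 * (1 - r) ^ 2 - 1) := mul_nonneg hr0 (by nlinarith)
    linarith

theorem tendsto_padicLogSeries_zero {α : Type*} {l : Filter α} {f : α → ℂ_[p]}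
    (hf : Tendsto f l (𝓝 1)) : Tendsto (fun a => padicLogSeries p (f a)) l (𝓝 0) := by
  have h1 : Tendsto (fun a => ‖f a - 1‖) l (𝓝 0) := by
    have := (hf.sub_const 1).norm
    simpa using this
  have h2 : Tendsto (fun a => 4 * ‖f a - 1‖) l (𝓝 0) := by simpa using h1.const_mul 4
  refine squeeze_zero_norm' ?_ h2
  filter_upwards [h1.eventually_le_const (u := 1 / 2) (by norm_num)] with a ha
  exact norm_padicLogSeries_le ha

/-- For `y` close to `1`, raising to the `p`-th power scales the distance to `1` by `|p|`. -/
theorem norm_pow_prime_sub_one {K : Type*} [NormedField K] [IsUltrametricDist K] {p : ℕ}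
    (hp : ‖(p : K)‖ < 1) {y : K} (hy : ‖y - 1‖ < ‖(p : K)‖) :
    ‖y ^ p - 1‖ = ‖(p : K)‖ * ‖y - 1‖ := by
  have hp0 : 0 < ‖(p : K)‖ := (norm_nonneg _).trans_lt hy
  have hy1 : ‖y‖ = 1 := norm_eq_one_of_norm_sub_one_lt (hy.trans hp)
  have e2 : (∑ i ∈ Finset.range p, y ^ i) = (∑ i ∈ Finset.range p, (y ^ i - 1)) + (p : K) := by
    simp
  have hs : ‖∑ i ∈ Finset.range p, (y ^ i - 1)‖ < ‖(p : K)‖ :=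
    (IsUltrametricDist.norm_sum_le_of_forall_le_of_nonneg (norm_nonneg _)
      fun i _ => norm_pow_sub_one_le hy1 i).trans_lt hy
  rw [← geom_sum_mul, norm_mul, e2,
    IsUltrametricDist.norm_add_eq_max_of_norm_ne_norm hs.ne, max_eq_right hs.le]

theorem norm_pow_prime_pow_sub_one {K : Type*} [NormedField K] [IsUltrametricDist K] {p : ℕ}
    (hp : ‖(p : K)‖ < 1) {y : K} (hy : ‖y - 1‖ < ‖(p : K)‖) (n : ℕ) :
    ‖y ^ p ^ n - 1‖ = ‖(p : K)‖ ^ n * ‖y - 1‖ := by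
  induction n with
  | zero => simp
  | succ n ih =>
    have h : ‖y ^ p ^ n - 1‖ < ‖(p : K)‖ :=
      (norm_pow_sub_one_le (norm_eq_one_of_norm_sub_one_lt (hy.trans hp)) _).trans_lt hy
    rw [pow_succ, pow_mul, norm_pow_prime_sub_one hp h, ih]
    ring

theorem norm_padicLogSeries_eq {x : ℂ_[p]} (hx : ‖x - 1‖ < ‖(p : ℂ_[p])‖) :
    ‖padicLogSeries p x‖ = ‖x - 1‖ := by
  refine tendsto_nhds_unique
    (tendsto_padicLogSeries (hx.trans PadicComplex.norm_prime_lt_one)).norm ?_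
  refine tendsto_const_nhds.congr fun n => ?_
  have : ‖(p : ℂ_[p])‖ ^ n ≠ 0 := pow_ne_zero _ (norm_ne_zero_iff.mpr PadicComplex.prime_ne_zero)
  rw [norm_div, norm_pow, norm_pow_prime_pow_sub_one (PadicComplex.norm_prime_lt_one (p := p)) hx,
    mul_div_cancel_left₀ _ this]

/-- The kernel of the `p`-adic logarithm on principal units consists of roots of unity. -/
theorem exists_pow_eq_one_of_padicLogSeries_eq_zero {x : ℂ_[p]} (hx : ‖x - 1‖ < 1)
    (h : padicLogSeries p x = 0) : ∃ n : ℕ, 0 < n ∧ x ^ n = 1 := by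
  have hx0 : x ≠ 0 := by
    rintro rfl
    simp at hx
  obtain ⟨m, hm⟩ := principalUnits_tendsto_pow (K := ℂ_[p])
    (PadicComplex.norm_prime_lt_one (p := p)) ⟨Units.mk0 x hx0, hx⟩
    (norm_pos_iff.mpr (PadicComplex.prime_ne_zero (p := p)))
  have h1 : ‖x ^ p ^ m - 1‖ < ‖(p : ℂ_[p])‖ := by
    have := hm ((p ^ m : ℕ) : ℤ) (by push_cast; exact dvd_rfl)
    rw [zpow_natCast] at this
    simpa using this
  refine ⟨p ^ m, pow_pos (Fact.out : p.Prime).pos m, ?_⟩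
  rw [← sub_eq_zero, ← norm_eq_zero, ← norm_padicLogSeries_eq h1, padicLogSeries_pow hx, h,
    mul_zero, norm_zero]

end PadicLog

/-- If a non-zero scalar maps a module into a submodule, the submodule has at least its rank. -/
theorem rank_le_rank_of_smul_mem {R V : Type*} [CommRing R] [IsDomain R] [AddCommGroup V]
    [Module R V] (S : Submodule R V) {c : R} (hc : c ≠ 0) (h : ∀ v, c • v ∈ S) :
    Module.rank R V ≤ Module.rank R S := by
  rw [Module.rank_def R V]
  refine ciSup_le' fun s => ?_
  have hs : LinearIndependent R (fun v : s.1 => (v : V)) := s.2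
  have h1 : LinearIndependent R (fun v : s.1 => c • (v : V)) := by
    rw [linearIndependent_iff'] at hs ⊢
    intro t g hg i hi
    have := hs t (fun j => g j * c) (by simpa [mul_smul] using hg) i hi
    exact (mul_eq_zero.mp this).resolve_right hc
  have h2 : LinearIndependent R (fun v : s.1 => (⟨c • (v : V), h v⟩ : S)) :=
    LinearIndependent.of_comp S.subtype h1
  exact h2.cardinal_le_rank

section Units

variable {M : Type*} [Field M] [NumberField M]

open NumberField.Units NumberField.Units.dirichletUnitTheorem

/-- The exponents of a unit with respect to a fundamental system. -/
noncomputable def unitExponents (x : (𝓞 M)ˣ) : Fin (rank M) → ℤ :=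
  (exist_unique_eq_mul_prod M x).choose.2

theorem exists_eq_torsion_mul_prod (x : (𝓞 M)ˣ) :
    ∃ ζ : torsion M, x = ζ * ∏ j, fundSystem M j ^ unitExponents x j :=
  ⟨_, (exist_unique_eq_mul_prod M x).choose_spec.1⟩

theorem pow_torsionOrder_eq_one {K : Type*} [Field K] (ζ : torsion K) :
    (ζ : (𝓞 K)ˣ) ^ torsionOrder K = 1 := by
  rw [← Subgroup.coe_pow, torsionOrder, pow_card_eq_one', Subgroup.coe_one]

theorem torsionOrder_smul_map_eq_sum {V : Type*} [AddCommGroup V]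
    (f : Additive (𝓞 M)ˣ →+ V) (x : (𝓞 M)ˣ) :
    torsionOrder M • f (Additive.ofMul x) =
      torsionOrder M • ∑ j, unitExponents x j • f (Additive.ofMul (fundSystem M j)) := by
  obtain ⟨ζ, he⟩ := exists_eq_torsion_mul_prod x
  have h : torsionOrder M • f (Additive.ofMul (ζ : (𝓞 M)ˣ)) = 0 := by
    rw [← map_nsmul, ← ofMul_pow, pow_torsionOrder_eq_one, ofMul_one, map_zero]
  conv_lhs => rw [he]
  rw [ofMul_mul, map_add, smul_add, h, zero_add, ofMul_prod, map_sum]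
  simp [ofMul_zpow]

/-- A homomorphism from the units to a group without torsion is determined by its values on a
fundamental system. -/
theorem map_eq_sum_fundSystem {V : Type*} [AddCommGroup V] [IsAddTorsionFree V]
    (f : Additive (𝓞 M)ˣ →+ V) (x : (𝓞 M)ˣ) :
    f (Additive.ofMul x) = ∑ j, unitExponents x j • f (Additive.ofMul (fundSystem M j)) :=
  nsmul_right_injective (torsionOrder_ne_zero M) (torsionOrder_smul_map_eq_sum f x)

/-- The action of a field automorphism on the units. -/
noncomputable def galoisUnits (g : Gal(M/ℚ)) : (𝓞 M)ˣ →* (𝓞 M)ˣ :=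
  Units.map (RingOfIntegers.mapRingHom (g : M →+* M)).toMonoidHom

theorem coe_galoisUnits (g : Gal(M/ℚ)) (u : (𝓞 M)ˣ) :
    ((galoisUnits g u : 𝓞 M) : M) = g (u : 𝓞 M) := rfl

/-- The logarithm of an archimedean absolute value on the units. -/
noncomputable def logPlace (w : InfinitePlace M) : Additive (𝓞 M)ˣ →+ ℝ where
  toFun u := Real.log (w ((u.toMul : 𝓞 M) : M))
  map_zero' := by simp
  map_add' u v := by
    simp only [toMul_add, Units.val_mul, map_mul]
    exact Real.log_mul (by simp) (by simp)

theorem eq_zero_of_sum_mul_galois_eq_zero [IsGalois ℚ M] {C : Type*} [Field C] [Algebra ℚ C]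
    (f : Additive (𝓞 M)ˣ →+ C)
    (hf : AlgebraicIndependent ℚ fun j => f (Additive.ofMul (fundSystem M j)))
    (a : Fin (rank M) → C)
    (ha : ∀ g : Gal(M/ℚ), ∑ i, a i * f (Additive.ofMul (galoisUnits g (fundSystem M i))) = 0) :
    a = 0 := by
  classical
  have : CharZero C := algebraRat.charZero C
  have hg : ∀ w : InfinitePlace M, ∃ g : Gal(M/ℚ), ∀ x : M, w x = w₀ (g x) := by
    intro w
    obtain ⟨g, hg⟩ := InfinitePlace.exists_smul_eq_of_comap_eq (k := ℚ) (w := w₀) (w' := w)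
      (Subsingleton.elim _ _)
    exact ⟨g.symm, fun x => by rw [← hg]; rfl⟩
  choose g hg using hg
  let e := equivFinRank M
  let u := fundSystem M
  let P : Matrix {w : InfinitePlace M // w ≠ w₀} {w : InfinitePlace M // w ≠ w₀}
      (MvPolynomial (Fin (rank M)) ℚ) := Matrix.of fun i w =>
    (w.1.mult : MvPolynomial (Fin (rank M)) ℚ) *
      ∑ j, unitExponents (galoisUnits (g w.1) (u (e.symm i))) j • MvPolynomial.X j
  have hP : P.det ≠ 0 := by
    intro h0
    have h1 := congrArg (MvPolynomial.aeval fun j => logPlace w₀ (Additive.ofMul (u j))) h0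
    rw [AlgHom.map_det, map_zero] at h1
    refine regOfFamily_ne_zero (isMaxRank_fundSystem M) ?_
    rw [regOfFamily_eq_det', abs_eq_zero, ← h1]
    congr 1
    ext i w
    have h2 := map_eq_sum_fundSystem (logPlace w₀) (galoisUnits (g w.1) (u (e.symm i)))
    simp only [AlgHom.mapMatrix_apply, Matrix.map_apply, Matrix.of_apply, P, map_mul, map_natCast,
      map_sum, map_zsmul, MvPolynomial.aeval_X, logEmbedding_component]
    rw [← h2, logPlace]
    simp only [AddMonoidHom.coe_mk, ZeroHom.coe_mk, toMul_ofMul, coe_galoisUnits, ← hg]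
    rfl
  have hQ : ((MvPolynomial.aeval fun j => f (Additive.ofMul (u j))).mapMatrix P).det ≠ 0 := by
    rw [← AlgHom.map_det]
    exact fun h => hP ((injective_iff_map_eq_zero _).mp hf _ h)
  have h3 : (fun i => a (e.symm i)) = 0 := by
    refine Matrix.eq_zero_of_vecMul_eq_zero hQ ?_
    ext w
    have h4 := ha (g w.1)
    rw [← e.symm.sum_comp] at h4
    have h5 := congrArg ((w.1.mult : C) * ·) h4
    simp only [mul_zero, Finset.mul_sum] at h5
    rw [Pi.zero_apply, ← h5]
    refine Finset.sum_congr rfl fun i _ => ?_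
    rw [map_eq_sum_fundSystem f]
    simp only [AlgHom.mapMatrix_apply, Matrix.map_apply, Matrix.of_apply, P, map_mul, map_natCast,
      map_sum, map_zsmul, MvPolynomial.aeval_X]
    ring
  ext i
  simpa using congrFun h3 (e i)

end Units

section Embedding

variable {p : ℕ} [Fact p.Prime] {M : Type*} [Field M] [NumberField M]

theorem norm_map_le_one_of_isIntegral {R K : Type*} [CommRing R] [NormedField K]
    [IsUltrametricDist K] (φ : R →+* K) {x : R} (hx : IsIntegral ℤ x) : ‖φ x‖ ≤ 1 := by
  have h1 : IsIntegral ℤ (φ x) := hx.map φ.toIntAlgHom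
  have h2 : IsIntegral (NormedField.valuation (K := K)).integer (φ x) := h1.tower_top
  exact (Valuation.integer.integers (NormedField.valuation (K := K))).mem_of_integral h2

theorem norm_map_integer_le_one {K : Type*} [Field K] (φ : 𝓞 K →+* ℂ_[p]) (x : 𝓞 K) :
    ‖φ x‖ ≤ 1 :=
  norm_map_le_one_of_isIntegral φ (RingOfIntegers.isIntegral x)

/-- The prime of `𝓞 M` above `p` that a homomorphism `𝓞 M → ℂ_p` induces. -/
noncomputable def inducedPrime (φ : 𝓞 M →+* ℂ_[p]) : PrimesAbove p M :=
  ⟨{ asIdeal :=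
      { carrier := {x | ‖φ x‖ < 1}
        zero_mem' := by simp
        add_mem' := fun {x y} hx hy => by
          simp only [Set.mem_ofPred_eq, map_add] at hx hy ⊢
          exact (IsUltrametricDist.norm_add_le_max _ _).trans_lt (max_lt hx hy)
        smul_mem' := fun c x hx => by
          simp only [Set.mem_ofPred_eq, smul_eq_mul, map_mul, norm_mul] at hx ⊢
          exact (mul_le_of_le_one_left (norm_nonneg _) (norm_map_integer_le_one φ c)).trans_lt hx }
     isPrime := by
      refine ⟨fun h => ?_, fun {x y} hxy => ?_⟩
      · have h1 : (1 : 𝓞 M) ∈ (⊤ : Ideal (𝓞 M)) := trivial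
        rw [← h] at h1
        have h2 : ‖φ (1 : 𝓞 M)‖ < 1 := h1
        simp at h2
      · by_contra! hn
        have hx : 1 ≤ ‖φ x‖ := not_lt.mp hn.1
        have hy : 1 ≤ ‖φ y‖ := not_lt.mp hn.2
        have hxy' : ‖φ (x * y)‖ < 1 := hxy
        rw [map_mul, norm_mul] at hxy'
        exact hxy'.not_ge (one_le_mul_of_one_le_of_one_le hx hy)
     ne_bot := by
      intro h
      have h1 : (p : 𝓞 M) ∈ (⊥ : Ideal (𝓞 M)) := by
        rw [← h]
        change ‖φ (p : 𝓞 M)‖ < 1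
        simpa using PadicComplex.norm_prime_lt_one (p := p)
      rw [Ideal.mem_bot, Nat.cast_eq_zero] at h1
      exact (Fact.out : p.Prime).ne_zero h1 }, by
    change ‖φ (p : 𝓞 M)‖ < 1
    simpa using PadicComplex.norm_prime_lt_one (p := p)⟩

theorem mem_inducedPrime {φ : 𝓞 M →+* ℂ_[p]} {x : 𝓞 M} :
    x ∈ (inducedPrime φ).1.asIdeal ↔ ‖φ x‖ < 1 := Iff.rfl

theorem exists_norm_map_le_pow (φ : 𝓞 M →+* ℂ_[p]) : ∃ c : ℝ, 0 ≤ c ∧ c < 1 ∧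
    ∀ n : ℕ, ∀ x ∈ (inducedPrime φ).1.asIdeal ^ n, ‖φ x‖ ≤ c ^ n := by
  obtain ⟨s, hs⟩ := IsNoetherian.noetherian (inducedPrime φ).1.asIdeal
  have hc : s.sup (fun x : 𝓞 M => ‖φ x‖₊) < 1 := by
    rw [Finset.sup_lt_iff (by simp)]
    intro x hx
    have : x ∈ (inducedPrime φ).1.asIdeal := by
      rw [← hs]
      exact Submodule.subset_span hx
    exact_mod_cast mem_inducedPrime.mp this
  set c := s.sup (fun x : 𝓞 M => ‖φ x‖₊) with hcdef
  have h1 : ∀ x ∈ (inducedPrime φ).1.asIdeal, ‖φ x‖ ≤ c := by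
    intro x hx
    rw [← hs] at hx
    induction hx using Submodule.span_induction with
    | mem x hx => exact_mod_cast Finset.le_sup (f := fun x : 𝓞 M => ‖φ x‖₊) hx
    | zero => simp
    | add x y _ _ hx hy =>
      rw [map_add]
      exact (IsUltrametricDist.norm_add_le_max _ _).trans (max_le hx hy)
    | smul a x _ hx =>
      rw [smul_eq_mul, map_mul, norm_mul]
      exact (mul_le_of_le_one_left (norm_nonneg _) (norm_map_integer_le_one φ a)).trans hx
  refine ⟨c, c.2, by exact_mod_cast hc, fun n => ?_⟩
  induction n with
  | zero => exact fun x _ => by simpa using norm_map_integer_le_one φ x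
  | succ n ih =>
    intro x hx
    rw [pow_succ] at hx
    induction hx using Submodule.mul_induction_on' with
    | mem_mul_mem a ha b hb =>
      rw [map_mul, norm_mul, pow_succ]
      exact mul_le_mul (ih a ha) (h1 b hb) (norm_nonneg _) (pow_nonneg c.2 n)
    | add x _ y _ hx hy =>
      rw [map_add]
      exact (IsUltrametricDist.norm_add_le_max _ _).trans (max_le hx hy)

/-- A homomorphism `𝓞 M → ℂ_p` is continuous for the topology of the induced prime. -/
theorem tendsto_map_of_tendsto_adic (φ : 𝓞 M →+* ℂ_[p]) {α : Type*} {l : Filter α} {y : α → 𝓞 M}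
    (hy : Tendsto (fun k => algebraMap (𝓞 M) ((inducedPrime φ).1.adicCompletion M) (y k)) l
      (𝓝 0)) : Tendsto (fun k => φ (y k)) l (𝓝 0) := by
  obtain ⟨c, hc0, hc1, hc⟩ := exists_norm_map_le_pow φ
  rw [Metric.tendsto_nhds]
  intro ε hε
  obtain ⟨n, hn⟩ := exists_pow_lt_of_lt_one hε hc1
  set v := (inducedPrime φ).1 with hv
  have hpos : (0 : ℝ) < WithZeroMulInt.toNNReal (HeightOneSpectrum.absNorm_ne_zero v)
      (WithZero.exp (-(n : ℤ))) := by
    rw [NNReal.coe_pos]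
    exact WithZeroMulInt.toNNReal_pos _ WithZero.exp_ne_zero
  have h1 := Metric.tendsto_nhds.mp hy _ hpos
  filter_upwards [h1] with k hk
  rw [dist_zero_right] at hk ⊢
  refine (hc n _ ?_).trans_lt hn
  rw [← HeightOneSpectrum.intValuation_le_pow_iff_mem]
  have h2 : ‖algebraMap (𝓞 M) (v.adicCompletion M) (y k)‖ =
      WithZeroMulInt.toNNReal (HeightOneSpectrum.absNorm_ne_zero v) (v.intValuation (y k)) :=
    FinitePlace.norm_embedding_int M v (y k)
  rw [h2, NNReal.coe_lt_coe] at hk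
  exact ((WithZeroMulInt.toNNReal_strictMono
    (HeightOneSpectrum.one_lt_absNorm_nnreal v)).lt_iff_lt.mp hk).le

end Embedding

section PadicInt

variable {p : ℕ} [Fact p.Prime]

theorem PadicInt.tendsto_natCast_appr (a : ℤ_[p]) :
    Tendsto (fun n : ℕ => (a.appr n : ℤ_[p])) atTop (𝓝 a) := by
  rw [tendsto_iff_norm_sub_tendsto_zero]
  have h : Tendsto (fun n : ℕ => ((p : ℝ)⁻¹) ^ n) atTop (𝓝 0) :=
    tendsto_pow_atTop_nhds_zero_of_lt_one (by positivity)
      (inv_lt_one_of_one_lt₀ (by exact_mod_cast (Fact.out : p.Prime).one_lt))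
  refine squeeze_zero (fun n => norm_nonneg _) (fun n => ?_) h
  rw [norm_sub_rev]
  have := (PadicInt.norm_le_pow_iff_mem_span_pow _ n).mpr (PadicInt.appr_spec n a)
  rwa [zpow_neg, zpow_natCast, ← inv_pow] at this

theorem PadicComplex.tendsto_natCast_appr (a : ℤ_[p]) :
    Tendsto (fun n : ℕ => (a.appr n : ℂ_[p])) atTop (𝓝 (algebraMap ℚ_[p] ℂ_[p] a)) := by
  have h1 : Continuous fun a : ℤ_[p] => algebraMap ℚ_[p] ℂ_[p] a :=
    (continuous_algebraMap ℚ_[p] ℂ_[p]).comp continuous_subtype_val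
  refine ((h1.tendsto a).comp (PadicInt.tendsto_natCast_appr a)).congr fun n => ?_
  simp

theorem HasPadicExponents.continuous_padicSMul {A : Type*} [AddCommGroup A] [TopologicalSpace A]
    [IsTopologicalAddGroup A] [T2Space A] (h : HasPadicExponents p A) (x : A) :
    Continuous fun a : ℤ_[p] => padicSMul a x := by
  let f : ℤ_[p] →+ A := AddMonoidHom.mk' (fun a => padicSMul a x) fun a b => h.add_smul' a b x
  refine continuous_of_continuousAt_zero f ?_
  rw [ContinuousAt, map_zero, tendsto_def]
  intro U hU
  obtain ⟨m, hm⟩ := h.small_padic x U hU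
  have hpos : (0 : ℝ) < (p : ℝ) ^ (-(m : ℤ)) :=
    zpow_pos (by exact_mod_cast (Fact.out : p.Prime).pos) _
  filter_upwards [Metric.ball_mem_nhds (0 : ℤ_[p]) hpos] with c hc
  rw [mem_ball_zero_iff] at hc
  exact hm c (Ideal.mem_span_singleton.mp ((PadicInt.norm_le_pow_iff_mem_span_pow c m).mp hc.le))

end PadicInt

section PrincipalPowers

open NumberField.Units NumberField.Units.dirichletUnitTheorem

variable (p : ℕ) {M : Type*} [Field M]

/-- The order of the group of units modulo `p`. -/
noncomputable def modUnitsOrder (M : Type*) [Field M] : ℕ :=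
  Nat.card (𝓞 M ⧸ Ideal.span {(p : 𝓞 M)})ˣ

theorem modUnitsOrder_ne_zero [Fact p.Prime] (M : Type*) [Field M] [NumberField M] :
    modUnitsOrder p M ≠ 0 := by
  have : Finite (𝓞 M ⧸ Ideal.span {(p : 𝓞 M)}) := by
    refine Ideal.finiteQuotientOfFreeOfNeBot _ ?_
    rw [Ne, Ideal.span_singleton_eq_bot, Nat.cast_eq_zero]
    exact (Fact.out : p.Prime).ne_zero
  exact Nat.card_pos.ne'

theorem dvd_pow_modUnitsOrder_sub_one (u : (𝓞 M)ˣ) :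
    (p : 𝓞 M) ∣ (u : 𝓞 M) ^ modUnitsOrder p M - 1 := by
  rw [← Ideal.mem_span_singleton, ← Ideal.Quotient.eq_zero_iff_mem, map_sub, map_pow, map_one,
    sub_eq_zero]
  have h : (Units.map (Ideal.Quotient.mk (Ideal.span {(p : 𝓞 M)})).toMonoidHom u) ^
      modUnitsOrder p M = 1 := pow_card_eq_one'
  exact congrArg Units.val h

theorem pow_modUnitsOrder_mem [NumberField M] (u : (𝓞 M)ˣ) :
    u ^ modUnitsOrder p M ∈ principalGlobalUnits p M := by
  refine Subgroup.mem_iInf.mpr fun v => ?_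
  have h : (u : 𝓞 M) ^ modUnitsOrder p M - 1 ∈ v.1.asIdeal :=
    v.1.asIdeal.mem_of_dvd (dvd_pow_modUnitsOrder_sub_one p u) v.2
  have h2 : ‖algebraMap (𝓞 M) (v.1.adicCompletion M) ((u : 𝓞 M) ^ modUnitsOrder p M - 1)‖ < 1 :=
    (FinitePlace.norm_lt_one_iff_mem M v.1 _).mpr h
  rw [map_sub, map_one] at h2
  exact h2

variable {p} [Fact p.Prime]

theorem norm_map_pow_modUnitsOrder_sub_one_lt (φ : 𝓞 M →+* ℂ_[p]) (u : (𝓞 M)ˣ) :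
    ‖φ u ^ modUnitsOrder p M - 1‖ < 1 := by
  obtain ⟨y, hy⟩ := dvd_pow_modUnitsOrder_sub_one p u
  rw [← map_pow, ← map_one φ, ← map_sub, hy, map_mul, map_natCast, norm_mul]
  exact mul_lt_one_of_nonneg_of_lt_one_left (norm_nonneg _) PadicComplex.norm_prime_lt_one
    (norm_map_integer_le_one φ y)

/-- The `p`-adic logarithm of a principal power of a unit. -/
noncomputable def padicLogUnits (φ : 𝓞 M →+* ℂ_[p]) : Additive (𝓞 M)ˣ →+ ℂ_[p] where
  toFun u := padicLogSeries p (φ u.toMul ^ modUnitsOrder p M)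
  map_zero' := by simp [padicLogSeries_one]
  map_add' u v := by
    rw [toMul_add, Units.val_mul, map_mul, mul_pow]
    exact padicLogSeries_mul (norm_map_pow_modUnitsOrder_sub_one_lt φ _)
      (norm_map_pow_modUnitsOrder_sub_one_lt φ _)

theorem padicLogUnits_eq_padicLog (φ : 𝓞 M →+* ℂ_[p]) (u : (𝓞 M)ˣ) :
    padicLogUnits φ (Additive.ofMul u) = padicLog p (φ u ^ modUnitsOrder p M) := by
  rw [padicLog, if_pos (norm_map_pow_modUnitsOrder_sub_one_lt φ u)]
  rfl

variable [NumberField M]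

theorem exists_nsmul_eq_zero_of_padicLogUnits_eq_zero {φ : 𝓞 M →+* ℂ_[p]}
    (hφ : Function.Injective φ) {x : Additive (𝓞 M)ˣ} (hx : padicLogUnits φ x = 0) :
    ∃ n : ℕ, n ≠ 0 ∧ n • x = 0 := by
  obtain ⟨n, hn, h⟩ := exists_pow_eq_one_of_padicLogSeries_eq_zero
    (norm_map_pow_modUnitsOrder_sub_one_lt φ x.toMul) hx
  refine ⟨modUnitsOrder p M * n, mul_ne_zero (modUnitsOrder_ne_zero p M) hn.ne', ?_⟩
  rw [← pow_mul, ← map_pow, ← map_one φ] at h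
  have h2 : x.toMul ^ (modUnitsOrder p M * n) = 1 := Units.ext (by simpa using hφ h)
  exact congrArg Additive.ofMul h2

theorem linearIndependent_padicLogUnits {φ : 𝓞 M →+* ℂ_[p]} (hφ : Function.Injective φ) :
    LinearIndependent ℚ fun j => padicLogUnits φ (Additive.ofMul (fundSystem M j)) := by
  rw [← LinearIndependent.iff_fractionRing ℤ ℚ, Fintype.linearIndependent_iff]
  intro g hg
  have h1 : padicLogUnits φ (∑ j, g j • Additive.ofMul (fundSystem M j)) = 0 := by
    rw [map_sum, ← hg]
    simp
  obtain ⟨n, hn, h2⟩ := exists_nsmul_eq_zero_of_padicLogUnits_eq_zero hφ h1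
  have h3 : logEmbedding M (∑ j, g j • Additive.ofMul (fundSystem M j)) = 0 := by
    have := congrArg (logEmbedding M) h2
    rw [map_nsmul, map_zero] at this
    exact (smul_eq_zero_iff_right hn).mp this
  have h4 := Fintype.linearIndependent_iff.mp (isMaxRank_fundSystem M) (fun j => (g j : ℝ)) (by
    rw [← h3, map_sum]
    simp [Int.cast_smul_eq_zsmul])
  exact fun i => by exact_mod_cast h4 i

theorem isAlgebraic_map {K C : Type*} [Field K] [NumberField K] [Field C] [Algebra ℚ C]
    (φ : K →+* C) (x : K) : IsAlgebraic ℚ (φ x) :=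
  (Algebra.IsAlgebraic.isAlgebraic (R := ℚ) x).algHom φ.toRatAlgHom

theorem algebraicIndependent_padicLogUnits (h : PadicSchanuelConjecture p) (φ : M →+* ℂ_[p]) :
    AlgebraicIndependent ℚ fun j =>
      padicLogUnits (φ.comp (algebraMap (𝓞 M) M)) (Additive.ofMul (fundSystem M j)) := by
  have hφ : Function.Injective (φ.comp (algebraMap (𝓞 M) M)) :=
    φ.injective.comp RingOfIntegers.coe_injective
  have h1 := linearIndependent_padicLogUnits (p := p) hφ
  simp only [padicLogUnits_eq_padicLog] at h1 ⊢
  refine h _ _ (fun i => pow_ne_zero _ ?_) (fun i => (isAlgebraic_map φ _).pow _) h1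
  exact (map_ne_zero φ).mpr (RingOfIntegers.coe_ne_zero_iff.mpr (Units.ne_zero _))

end PrincipalPowers

section Leopoldt

open NumberField.Units NumberField.Units.dirichletUnitTheorem

variable (p : ℕ) {M : Type*} [Field M] [NumberField M]

/-- The diagonal image of the principal power of a unit. -/
noncomputable def diagonalPow :
    Additive (𝓞 M)ˣ →+ ∀ v : PrimesAbove p M, PrincipalLocalUnits p M v :=
  (diagonalEmbedding p M).comp (MonoidHom.toAdditive
    ((powMonoidHom (modUnitsOrder p M)).codRestrict (principalGlobalUnits p M)
      (pow_modUnitsOrder_mem p)))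

variable {p}

theorem diagonalPow_mem_closure [Fact p.Prime] (x : Additive (𝓞 M)ˣ) :
    diagonalPow p x ∈ closureDiagonalUnits p M :=
  subset_closure ⟨_, rfl⟩

theorem coe_diagonalPow (x : Additive (𝓞 M)ˣ) (v : PrimesAbove p M) :
    (((diagonalPow p x v).toMul : (v.1.adicCompletion M)ˣ) : v.1.adicCompletion M) =
      algebraMap (𝓞 M) (v.1.adicCompletion M) ((x.toMul : 𝓞 M) ^ modUnitsOrder p M) := rfl

theorem diagonalPow_coe (x : principalGlobalUnits p M) :
    diagonalPow p (Additive.ofMul (x : (𝓞 M)ˣ)) =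
      modUnitsOrder p M • diagonalEmbedding p M (Additive.ofMul x) := by
  rw [← map_nsmul]
  rfl

variable [Fact p.Prime]

theorem continuous_smul_principalLocalUnits
    (x : ∀ v : PrimesAbove p M, PrincipalLocalUnits p M v) :
    Continuous fun a : ℤ_[p] => a • x :=
  continuous_pi fun v => (principalLocalUnits_hasPadicExponents v).continuous_padicSMul (x v)

theorem intCast_smul_principalLocalUnits (k : ℤ)
    (x : ∀ v : PrimesAbove p M, PrincipalLocalUnits p M v) : (k : ℤ_[p]) • x = k • x :=
  funext fun v => (principalLocalUnits_hasPadicExponents v).int_smul k (x v)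

theorem tendsto_appr_smul_principalLocalUnits (a : ℤ_[p])
    (x : ∀ v : PrimesAbove p M, PrincipalLocalUnits p M v) :
    Tendsto (fun n : ℕ => a.appr n • x) atTop (𝓝 (a • x)) :=
  tendsto_pi_nhds.mpr fun v => (principalLocalUnits_hasPadicExponents v).tendsto_appr a (x v)

/-- A `ℤ_p`-linear relation between diagonal images yields the same relation between `p`-adic
logarithms. -/
theorem sum_mul_padicLogUnits_eq_zero {ι : Type*} [Fintype ι] (a : ι → ℤ_[p])
    (u : ι → Additive (𝓞 M)ˣ) (h : ∑ i, a i • diagonalPow p (u i) = 0) (φ : 𝓞 M →+* ℂ_[p]) :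
    ∑ i, algebraMap ℚ_[p] ℂ_[p] (a i) * padicLogUnits φ (u i) = 0 := by
  let x : ℕ → Additive (𝓞 M)ˣ := fun n => ∑ i, (a i).appr n • u i
  have h1 : Tendsto (fun n => diagonalPow p (x n)) atTop (𝓝 0) := by
    rw [← h]
    refine (tendsto_finsetSum _ fun i _ =>
      tendsto_appr_smul_principalLocalUnits (a i) (diagonalPow p (u i))).congr fun n => ?_
    simp [x]
  have h2 : Tendsto (fun n => algebraMap (𝓞 M) ((inducedPrime φ).1.adicCompletion M)
      (((x n).toMul : 𝓞 M) ^ modUnitsOrder p M - 1)) atTop (𝓝 0) := by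
    have h3 := (principalUnits_isEmbedding.continuous.tendsto _).comp
      (tendsto_pi_nhds.mp h1 (inducedPrime φ))
    have h4 := h3.sub_const 1
    simp only [Pi.zero_apply, toMul_zero, OneMemClass.coe_one, Units.val_one, sub_self] at h4
    refine h4.congr fun n => ?_
    rw [map_sub, map_one, Function.comp_apply, coe_diagonalPow]
  have h5 : Tendsto (fun n => φ (x n).toMul ^ modUnitsOrder p M) atTop (𝓝 1) := by
    have := (tendsto_map_of_tendsto_adic φ h2).add_const 1
    simpa using this
  have h6 : Tendsto (fun n => padicLogUnits φ (x n)) atTop (𝓝 0) :=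
    tendsto_padicLogSeries_zero h5
  refine tendsto_nhds_unique ?_ h6
  refine (tendsto_finsetSum _ fun i _ =>
    (PadicComplex.tendsto_natCast_appr (a i)).mul_const (padicLogUnits φ (u i))).congr fun n => ?_
  simp [x]

theorem linearIndependent_diagonalPow [IsGalois ℚ M] (hS : PadicSchanuelConjecture p) :
    LinearIndependent ℤ_[p] fun i => diagonalPow p (Additive.ofMul (fundSystem M i)) := by
  rw [Fintype.linearIndependent_iff]
  intro a ha
  let φ : M →+* ℂ_[p] := (IsAlgClosed.lift (R := ℚ) (S := M) (M := ℂ_[p])).toRingHom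
  have h1 := eq_zero_of_sum_mul_galois_eq_zero _ (algebraicIndependent_padicLogUnits hS φ)
    (fun i => algebraMap ℚ_[p] ℂ_[p] (a i)) fun g =>
      sum_mul_padicLogUnits_eq_zero a _ ha
        ((φ.comp (algebraMap (𝓞 M) M)).comp (RingOfIntegers.mapRingHom (g : M →+* M)))
  intro i
  have h2 := congrFun h1 i
  simpa using h2

theorem rank_closureDiagonalUnits_le :
    Module.rank ℤ_[p] (closureDiagonalUnits p M) ≤ rank M := by
  let y : Fin (rank M) → closureDiagonalUnits p M := fun i =>
    ⟨diagonalPow p (Additive.ofMul (fundSystem M i)), diagonalPow_mem_closure _⟩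
  let F : (Fin (rank M) → ℤ_[p]) →ₗ[ℤ_[p]] closureDiagonalUnits p M :=
    Fintype.linearCombination ℤ_[p] y
  let G := (closureDiagonalUnits p M).subtype ∘ₗ F
  have hG : ∀ a, G a = ∑ i, a i • diagonalPow p (Additive.ofMul (fundSystem M i)) := by
    intro a
    simp [G, F, y, Fintype.linearCombination_apply]
  have hcont : Continuous G := by
    rw [funext hG]
    exact continuous_finsetSum _ fun i _ =>
      (continuous_smul_principalLocalUnits _).comp (continuous_apply i)
  have hclosed : IsClosed (Set.range G) := (isCompact_range hcont).isClosed
  let c := torsionOrder M * modUnitsOrder p M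
  have hsub : ∀ x ∈ closureDiagonalUnits p M, c • x ∈ Set.range G := by
    intro x hx
    have h1 : IsClosed {x : ∀ v : PrimesAbove p M, PrincipalLocalUnits p M v |
        c • x ∈ Set.range G} := hclosed.preimage (continuous_const_smul c)
    refine closure_minimal ?_ h1 hx
    rintro _ ⟨w, rfl⟩
    refine ⟨fun i => ((torsionOrder M * unitExponents (w.toMul : (𝓞 M)ˣ) i : ℤ) : ℤ_[p]), ?_⟩
    have h2 := torsionOrder_smul_map_eq_sum (diagonalPow p) (w.toMul : (𝓞 M)ˣ)
    rw [diagonalPow_coe, smul_smul] at h2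
    rw [hG]
    refine Eq.trans ?_ h2.symm
    rw [← Finset.sum_nsmul]
    refine Finset.sum_congr rfl fun i _ => ?_
    rw [intCast_smul_principalLocalUnits, mul_zsmul, natCast_zsmul]
  have hc : (c : ℤ_[p]) ≠ 0 := Nat.cast_ne_zero.mpr
    (mul_ne_zero (torsionOrder_ne_zero M) (modUnitsOrder_ne_zero p M))
  refine (rank_le_rank_of_smul_mem (R := ℤ_[p]) (V := closureDiagonalUnits p M)
    (LinearMap.range F) hc fun v => ?_).trans ?_
  · obtain ⟨a, ha⟩ := hsub v v.2
    refine ⟨a, Subtype.ext ?_⟩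
    rw [Nat.cast_smul_eq_nsmul]
    exact ha
  · have h := lift_rank_range_le F
    simpa using h

end Leopoldt

theorem mainTheorem2 (p : ℕ) [Fact p.Prime] (M : Type*) [Field M] [NumberField M] [IsGalois ℚ M]
    (hSchanuel : PadicSchanuelConjecture p) :
    Module.rank ℤ_[p] (closureDiagonalUnits p M) = Module.rank ℤ (Additive (𝓞 M)ˣ) := by
  rw [← Module.finrank_eq_rank ℤ (Additive (𝓞 M)ˣ), NumberField.Units.finrank_eq]
  refine le_antisymm rank_closureDiagonalUnits_le ?_
  have h : LinearIndependent ℤ_[p] fun i : Fin (NumberField.Units.rank M) =>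
      (⟨diagonalPow p (Additive.ofMul (NumberField.Units.fundSystem M i)),
        diagonalPow_mem_closure _⟩ : closureDiagonalUnits p M) :=
    LinearIndependent.of_comp (closureDiagonalUnits p M).subtype
      (linearIndependent_diagonalPow hSchanuel)
  simpa using h.cardinal_lift_le_rank
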